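/- Let $N\ge 1$ be an integer, let $T>0$, and let $\mathbf w=\big(\mathbf w(t)\big)_{0\le t\le T}$ be an $N$-dimensional standard Brownian motion on a probability space $(\Omega,\mathcal F,\mathbb P)$ (that is, the components of $\mathbf w$ are $N$ independent standard one-dimensional Brownian motions on $[0,T]$ started at $0$). Let $|\cdot|$ denote the Euclidean norm on $\mathbb R^N$. Then $$ \ln \mathbb P\left(\int_0^T |\mathbf w(t)|^2\,dt\le \varepsilon\right)\sim -\frac{N^2T^2}{8}\,\varepsilon^{-1},\qquad \varepsilon\to 0^+, $$ where $f(\varepsilon)\sim g(\varepsilon)$ means $\lim_{\varepsilon\to 0^+} f(\varepsilon)/g(\varepsilon)=1$. -/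

import Mathlib

open MeasureTheory ProbabilityTheory Set Filter Asymptotics
open scoped Topology

/-- `b` is (on the time interval `[0, T]`) a standard one-dimensional Brownian motion on the
probability space `(Ω, P)`: it starts at `0`, has independent increments, its increment over
`[s, t]` has the Gaussian law with mean `0` and variance `t - s`, and almost all its paths are
continuous. The values of `b` at times outside `[0, T]` play no role. -/
structure IsStandardBrownianOn {Ω : Type*} [MeasurableSpace Ω] (T : ℝ) (b : ℝ → Ω → ℝ)
    (P : Measure Ω) : Prop where
  start_zero : ∀ᵐ ω ∂P, b 0 ω = 0
  indep_increments : HasIndepIncrements (fun t : Icc (0 : ℝ) T => b t) P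
  law_increments : ∀ s t : ℝ, 0 ≤ s → s ≤ t → t ≤ T →
    HasLaw (fun ω => b t ω - b s ω) (gaussianReal 0 (t - s).toNNReal) P
  continuous_paths : ∀ᵐ ω ∂P, ContinuousOn (fun t => b t ω) (Icc 0 T)

/-- `w` is (on the time interval `[0, T]`) a standard `N`-dimensional Brownian motion: its `N`
components are independent (as processes on `[0, T]`) standard one-dimensional Brownian motions. -/
structure IsStandardBrownianVecOn {Ω : Type*} [MeasurableSpace Ω] {N : ℕ} (T : ℝ)
    (w : ℝ → Ω → EuclideanSpace ℝ (Fin N)) (P : Measure Ω) : Prop where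
  component : ∀ i : Fin N, IsStandardBrownianOn T (fun t ω => w t ω i) P
  indep_components : iIndepFun (fun (i : Fin N) (ω : Ω) (t : Icc (0 : ℝ) T) => w t ω i) P

/-! Let X be the energy `∫ ‖w t‖ ^ 2`. Everything rests on the Cameron–Martin formula E exp(-l²X/2)
= cosh(lT)^(-N/2), which lies between exp(-cl) and 2^(N/2) exp(-cl) for c = NT/2.

The formula comes from discretization. For a Gaussian walk, integrating out one step at a time gives
a Riccati recursion solved exactly by hyperbolic cosines (`integral_exp_neg_walkEnergy`);
independence of the components gives the power N, and refining the grid gives the formula.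

The Laplace bounds yield the small-ball rate c²/2 = N²T²/8
(`tendsto_mul_log_measureReal_of_laplace`): Chernoff's inequality, optimized at l = c/ε, gives the
upper bound, and exponential tilting gives the matching lower bound. -/

/-! ### Gaussian walks: exact Laplace transform of the energy -/

theorem integral_exp_neg_mul_add_sq_gaussianReal {v : NNReal} (hv : v ≠ 0) {c : ℝ}
    (hc : 0 < 1 + v * c) (x : ℝ) :
    ∫ y, Real.exp (-(c * (x + y) ^ 2 / 2)) ∂gaussianReal 0 v
      = (√(1 + v * c))⁻¹ * Real.exp (-(c / (1 + v * c) * x ^ 2 / 2)) := by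
  have hv' : (0 : ℝ) < v := by positivity
  rw [integral_gaussianReal_eq_integral_smul hv]
  have key : ∀ y : ℝ, gaussianPDFReal 0 v y • Real.exp (-(c * (x + y) ^ 2 / 2))
      = ((√(2 * Real.pi * v))⁻¹ * Real.exp (-(c / (1 + v * c) * x ^ 2 / 2))) *
        Real.exp (-((1 + v * c) / (2 * v)) * (y + v * c * x / (1 + v * c)) ^ 2) := by
    intro y
    rw [gaussianPDFReal, smul_eq_mul]
    simp only [mul_assoc, ← Real.exp_add]
    congr 2
    field_simp
    ring
  simp_rw [key]
  rw [integral_const_mul, integral_add_right_eq_self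
    (fun y => Real.exp (-((1 + v * c) / (2 * v)) * y ^ 2)), integral_gaussian]
  rw [mul_right_comm]
  congr 1
  rw [← Real.sqrt_inv, ← Real.sqrt_mul (by positivity), ← Real.sqrt_inv]
  congr 1
  field_simp

/-- The sum of the squares of the positions of the walk that starts at `x` and has steps `y`,
the starting position excluded. -/
def walkEnergy : (n : ℕ) → ℝ → (Fin n → ℝ) → ℝ
  | 0, _, _ => 0
  | n + 1, x, y => (x + y 0) ^ 2 + walkEnergy n (x + y 0) (Fin.tail y)

theorem continuous_walkEnergy (n : ℕ) :
    Continuous fun p : ℝ × (Fin n → ℝ) => walkEnergy n p.1 p.2 := by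
  induction n with
  | zero => exact continuous_const
  | succ n ih =>
    have h : Continuous fun p : ℝ × (Fin (n + 1) → ℝ) => (p.1 + p.2 0, Fin.tail p.2) := by
      unfold Fin.tail
      fun_prop
    have := ih.comp h
    simp only [walkEnergy]
    exact (by fun_prop : Continuous fun p : ℝ × (Fin (n + 1) → ℝ) => (p.1 + p.2 0) ^ 2).add this

theorem walkEnergy_nonneg (n : ℕ) (x : ℝ) (y : Fin n → ℝ) : 0 ≤ walkEnergy n x y := by
  induction n generalizing x with
  | zero => exact le_rfl
  | succ n ih => exact add_nonneg (sq_nonneg _) (ih _ _)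

theorem walkEnergy_increments (n : ℕ) (g : ℕ → ℝ) :
    walkEnergy n (g 0) (fun k => g (k + 1) - g k) = ∑ k ∈ Finset.range n, g (k + 1) ^ 2 := by
  induction n generalizing g with
  | zero => rfl
  | succ n ih =>
    rw [Finset.sum_range_succ', ← ih fun k => g (k + 1), add_comm (walkEnergy _ _ _)]
    change (g 0 + (g 1 - g 0)) ^ 2 + walkEnergy n (g 0 + (g 1 - g 0)) _ = _
    rw [add_sub_cancel]
    rfl

/-- Integrating out the first step sends the quadratic coefficient through c ↦ c / (1 + vc); writing
it with ratios of consecutive cosines linearizes this map. The half-integer shifts make the case n =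
0 trivial, since cosh is even. -/
theorem integral_exp_neg_walkEnergy {v : NNReal} (hv : v ≠ 0) {a m : ℝ}
    (ha : 0 ≤ a) (ham : a * v = Real.cosh m - 1) (n : ℕ) (x : ℝ) :
    ∫ y, Real.exp (-(a * walkEnergy n x y)) ∂Measure.pi (fun _ : Fin n => gaussianReal 0 v)
      = (√(Real.cosh ((n + 1 / 2) * m) / Real.cosh (m / 2)))⁻¹ *
        Real.exp (-((1 - Real.cosh ((n - 1 / 2) * m) / Real.cosh ((n + 1 / 2) * m)) / v
          * x ^ 2 / 2)) := by
  have hv' : (0 : ℝ) < v := by positivity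
  induction n generalizing x with
  | zero =>
    have h1 : Real.cosh ((1 / 2) * m) = Real.cosh (m / 2) := by ring_nf
    have h2 : Real.cosh ((-(1 / 2)) * m) = Real.cosh (m / 2) := by
      rw [← Real.cosh_neg]; ring_nf
    have h3 := (Real.cosh_pos (m / 2)).ne'
    simp only [walkEnergy, Nat.cast_zero, zero_add, zero_sub, h1, h2]
    simp [div_self h3]
  | succ n ih =>
    have hmp := (measurePreserving_piFinSuccAbove (fun _ : Fin (n + 1) => gaussianReal 0 v) 0).symm
    rw [← hmp.integral_comp' (g := fun y => Real.exp (-(a * walkEnergy (n + 1) x y)))]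
    have hw : ∀ p : ℝ × (Fin n → ℝ), walkEnergy (n + 1) x
        ((MeasurableEquiv.piFinSuccAbove (fun _ => ℝ) 0).symm p)
          = (x + p.1) ^ 2 + walkEnergy n (x + p.1) p.2 := by
      intro p
      simp only [walkEnergy, MeasurableEquiv.piFinSuccAbove_symm_apply, Fin.insertNthEquiv,
        Equiv.coe_fn_mk, Fin.insertNth_zero]
      rfl
    simp_rw [hw]
    have hcont : Continuous fun p : ℝ × (Fin n → ℝ) =>
        Real.exp (-(a * ((x + p.1) ^ 2 + walkEnergy n (x + p.1) p.2))) := by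
      have := (continuous_walkEnergy n).comp
        (by fun_prop : Continuous fun p : ℝ × (Fin n → ℝ) => (x + p.1, p.2))
      have h2 : Continuous fun p : ℝ × (Fin n → ℝ) => walkEnergy n (x + p.1) p.2 := this
      fun_prop
    rw [integral_prod]
    swap
    · refine Integrable.of_bound hcont.aestronglyMeasurable 1 (ae_of_all _ fun p => ?_)
      rw [Real.norm_eq_abs, Real.abs_exp, Real.exp_le_one_iff, neg_nonpos]
      exact mul_nonneg ha (add_nonneg (sq_nonneg _) (walkEnergy_nonneg _ _ _))
    simp_rw [mul_add, neg_add, Real.exp_add, integral_const_mul]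
    set C := Real.cosh ((n + 1 / 2) * m) with hC
    set C' := Real.cosh ((n - 1 / 2) * m) with hC'
    have hCpos : 0 < C := Real.cosh_pos _
    have hD : 0 < Real.cosh (m / 2) := Real.cosh_pos _
    have hrec : Real.cosh ((n + 1 + 1 / 2) * m) = 2 * Real.cosh m * C - C' := by
      have e1 : ((n : ℝ) + 1 + 1 / 2) * m = (n + 1 / 2) * m + m := by ring
      have e2 : ((n : ℝ) - 1 / 2) * m = (n + 1 / 2) * m - m := by ring
      rw [hC', hC, e1, e2, Real.cosh_add, Real.cosh_sub]
      ring
    have hnext : 0 < Real.cosh ((n + 1 + 1 / 2) * m) := Real.cosh_pos _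
    -- Total coefficient at the new position: its own energy plus the remaining walk. By the
    -- three-term recurrence `hrec`, 1 + vc is a ratio of consecutive cosines, so the prefactors
    -- telescope.
    set c := 2 * a + (1 - C' / C) / v with hc
    have hvc : 1 + v * c = Real.cosh ((n + 1 + 1 / 2) * m) / C := by
      rw [hrec, hc]
      field_simp
      linear_combination 2 * C * ham
    have hpos : 0 < 1 + v * c := by rw [hvc]; positivity
    have hcc : c / (1 + v * c) = (1 - C / Real.cosh ((n + 1 + 1 / 2) * m)) / v := by
      have : C / Real.cosh ((n + 1 + 1 / 2) * m) = (1 + v * c)⁻¹ := by rw [hvc, inv_div]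
      rw [this, div_eq_div_iff hpos.ne' hv'.ne', sub_mul, inv_mul_cancel₀ hpos.ne']
      ring
    have hfun : ∀ y : ℝ, Real.exp (-(a * (x + y) ^ 2)) *
        ∫ z, Real.exp (-(a * walkEnergy n (x + y) z)) ∂Measure.pi (fun _ : Fin n => gaussianReal 0 v)
          = (√(C / Real.cosh (m / 2)))⁻¹ * Real.exp (-(c * (x + y) ^ 2 / 2)) := by
      intro y
      rw [ih, mul_left_comm, ← Real.exp_add, hc]
      congr 2
      ring
    refine (integral_congr_ae (ae_of_all _ hfun)).trans ?_
    rw [integral_const_mul, integral_exp_neg_mul_add_sq_gaussianReal hv hpos, hcc, hvc, ← mul_assoc,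
      ← mul_inv, ← Real.sqrt_mul (by positivity)]
    have e : C / Real.cosh (m / 2) * (Real.cosh ((n + 1 + 1 / 2) * m) / C)
        = Real.cosh ((n + 1 + 1 / 2) * m) / Real.cosh (m / 2) := by field_simp
    have e' : ((n : ℝ) + 1 - 1 / 2) * m = (n + 1 / 2) * m := by ring
    push_cast
    rw [e, e']

theorem integral_indicator_one_of_nullMeasurableSet {Ω : Type*} [MeasurableSpace Ω]
    {P : Measure Ω} {s : Set Ω} (hs : NullMeasurableSet s P) :
    ∫ ω, s.indicator (1 : Ω → ℝ) ω ∂P = P.real s := by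
  rw [integral_indicator₀ hs]
  simp

/-! ### From Laplace transform to small-ball probability -/

section Tauberian

variable {Ω : Type*} [MeasurableSpace Ω] {P : Measure Ω} [IsProbabilityMeasure P] {X : Ω → ℝ}

theorem integrable_exp_neg_mul_of_nonneg (hX : AEMeasurable X P) (hX0 : ∀ ω, 0 ≤ X ω) {s : ℝ}
    (hs : 0 ≤ s) : Integrable (fun ω => Real.exp (-(s * X ω))) P := by
  refine Integrable.of_bound (by fun_prop) 1 (ae_of_all _ fun ω => ?_)
  rw [Real.norm_eq_abs, Real.abs_exp, Real.exp_le_one_iff, neg_nonpos]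
  exact mul_nonneg hs (hX0 ω)

theorem measureReal_le_exp_mul_integral (hX : AEMeasurable X P) (hX0 : ∀ ω, 0 ≤ X ω) {s : ℝ}
    (hs : 0 ≤ s) (ε : ℝ) :
    P.real {ω | X ω ≤ ε} ≤ Real.exp (s * ε) * ∫ ω, Real.exp (-(s * X ω)) ∂P := by
  have hmeas : NullMeasurableSet {ω | X ω ≤ ε} P := hX.nullMeasurable measurableSet_Iic
  have hint := integrable_exp_neg_mul_of_nonneg hX hX0 hs
  rw [← integral_const_mul, ← integral_indicator_one_of_nullMeasurableSet hmeas]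
  refine integral_mono_of_nonneg (ae_of_all _ fun ω => indicator_nonneg (by simp) ω)
    (hint.const_mul _) (ae_of_all _ fun ω => ?_)
  simp only [← Real.exp_add]
  by_cases hω : X ω ≤ ε
  · rw [indicator_of_mem (by exact hω), Pi.one_apply, Real.one_le_exp_iff]
    have : s * X ω ≤ s * ε := mul_le_mul_of_nonneg_left hω hs
    linarith
  · rw [indicator_of_notMem (by exact hω)]
    positivity

/-- Lower bound for a small-ball probability by exponential tilting: the parts of the tilted
expectation over `X < a` and over `X > ε` are bounded by the Laplace transform at two other
points. -/
theorem integral_exp_neg_mul_le_add (hX : AEMeasurable X P) (hX0 : ∀ ω, 0 ≤ X ω)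
    {s s₁ s₂ a ε : ℝ} (hs₁ : 0 ≤ s₁) (h₁ : s₁ ≤ s) (h₂ : s ≤ s₂) :
    ∫ ω, Real.exp (-(s * X ω)) ∂P ≤ Real.exp (-(s * a)) * P.real {ω | X ω ≤ ε}
      + Real.exp (-((s - s₁) * ε)) * ∫ ω, Real.exp (-(s₁ * X ω)) ∂P
      + Real.exp ((s₂ - s) * a) * ∫ ω, Real.exp (-(s₂ * X ω)) ∂P := by
  have hmeas : NullMeasurableSet {ω | X ω ≤ ε} P := hX.nullMeasurable measurableSet_Iic
  have i₁ := integrable_exp_neg_mul_of_nonneg hX hX0 hs₁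
  have i₂ := integrable_exp_neg_mul_of_nonneg hX hX0 (hs₁.trans (h₁.trans h₂))
  have i₀ : Integrable ({ω | X ω ≤ ε}.indicator (1 : Ω → ℝ)) P :=
    (integrable_const (1 : ℝ)).indicator₀ hmeas
  rw [← integral_indicator_one_of_nullMeasurableSet hmeas, ← integral_const_mul, ← integral_const_mul,
    ← integral_const_mul, ← integral_add (i₀.const_mul _) (i₁.const_mul _),
    ← integral_add (by exact (i₀.const_mul _).add (i₁.const_mul _)) (i₂.const_mul _)]
  refine integral_mono_of_nonneg (ae_of_all _ fun ω => by positivity)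
    (((i₀.const_mul _).add (i₁.const_mul _)).add (i₂.const_mul _)) (ae_of_all _ fun ω => ?_)
  simp only [← Real.exp_add]
  have e₁ := Real.exp_pos (-((s - s₁) * ε) + -(s₁ * X ω))
  have e₂ := Real.exp_pos ((s₂ - s) * a + -(s₂ * X ω))
  by_cases hω : X ω ≤ ε
  · rw [indicator_of_mem (by exact hω), Pi.one_apply, mul_one]
    rcases le_total a (X ω) with h | h
    · have : Real.exp (-(s * X ω)) ≤ Real.exp (-(s * a)) :=
        Real.exp_le_exp.2 (neg_le_neg (mul_le_mul_of_nonneg_left h (hs₁.trans h₁)))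
      linarith
    · have : Real.exp (-(s * X ω)) ≤ Real.exp ((s₂ - s) * a + -(s₂ * X ω)) :=
        Real.exp_le_exp.2 (by nlinarith [mul_le_mul_of_nonneg_left h (sub_nonneg.2 h₂)])
      have := Real.exp_pos (-(s * a))
      linarith
  · rw [indicator_of_notMem (by exact hω), mul_zero]
    have : Real.exp (-(s * X ω)) ≤ Real.exp (-((s - s₁) * ε) + -(s₁ * X ω)) :=
      Real.exp_le_exp.2 (by nlinarith [mul_le_mul_of_nonneg_left (not_le.1 hω).le (sub_nonneg.2 h₁)])
    linarith

/-- Tilting with l = rc/ε concentrates X near c/l = ε/r, inside the window from ε/r² to ε, so both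
tails are exponentially negligible. -/
theorem exp_le_measureReal_of_laplace (hX : AEMeasurable X P) (hX0 : ∀ ω, 0 ≤ X ω) {c K : ℝ}
    (hc : 0 < c)
    (hlow : ∀ l, 0 < l → Real.exp (-(c * l)) ≤ ∫ ω, Real.exp (-(l ^ 2 / 2 * X ω)) ∂P)
    (hup : ∀ l, 0 < l → ∫ ω, Real.exp (-(l ^ 2 / 2 * X ω)) ∂P ≤ K * Real.exp (-(c * l)))
    {r ε : ℝ} (hr : 1 < r) (hε : 0 < ε) :
    (1 - 2 * K * Real.exp (-(c ^ 2 / ε * ((r - 1) ^ 2 / 2)))) *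
      Real.exp (-(c ^ 2 / ε * (r - 1 / 2))) ≤ P.real {ω | X ω ≤ ε} := by
  have hr0 : 0 < r := by linarith
  have hce : 0 < c / ε := by positivity
  have hlt : c / ε ≤ r * (c / ε) := by nlinarith
  have hlt' : r * (c / ε) ≤ r ^ 2 * (c / ε) := by nlinarith
  -- The Chernoff-optimal parameter at level x is l = c/x; `s₁` and `s₂` use it at the ends ε and
  -- ε/r². Both tails then carry the same factor relative to the main term.
  have key := integral_exp_neg_mul_le_add (ε := ε) (a := ε / r ^ 2) (s := (r * (c / ε)) ^ 2 / 2)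
    (s₁ := (c / ε) ^ 2 / 2) (s₂ := (r ^ 2 * (c / ε)) ^ 2 / 2) hX hX0 (by positivity)
    (by gcongr) (by gcongr)
  have l0 := hlow (r * (c / ε)) (by positivity)
  have u1 := mul_le_mul_of_nonneg_left (hup (c / ε) (by positivity))
    (Real.exp_pos (-(((r * (c / ε)) ^ 2 / 2 - (c / ε) ^ 2 / 2) * ε))).le
  have u2 := mul_le_mul_of_nonneg_left (hup (r ^ 2 * (c / ε)) (by positivity))
    (Real.exp_pos (((r ^ 2 * (c / ε)) ^ 2 / 2 - (r * (c / ε)) ^ 2 / 2) * (ε / r ^ 2))).le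
  rw [mul_left_comm, ← Real.exp_add] at u1 u2
  set A := c ^ 2 / ε with hA
  have x0 : -(c * (r * (c / ε))) = -(A * r) := by rw [hA]; field_simp
  have x1 : -(((r * (c / ε)) ^ 2 / 2 - (c / ε) ^ 2 / 2) * ε) + -(c * (c / ε))
      = -(A * ((r - 1) ^ 2 / 2)) + -(A * r) := by rw [hA]; field_simp; ring
  have x2 : ((r ^ 2 * (c / ε)) ^ 2 / 2 - (r * (c / ε)) ^ 2 / 2) * (ε / r ^ 2)
      + -(c * (r ^ 2 * (c / ε))) = -(A * ((r - 1) ^ 2 / 2)) + -(A * r) := by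
    rw [hA]; field_simp; ring
  have x3 : -((r * (c / ε)) ^ 2 / 2 * (ε / r ^ 2)) = -(A / 2) := by rw [hA]; field_simp
  rw [x1, Real.exp_add] at u1
  rw [x2, Real.exp_add] at u2
  rw [x0] at l0
  rw [x3] at key
  have x4 : Real.exp (-(A * (r - 1 / 2))) = Real.exp (-(A * r)) * Real.exp (A / 2) := by
    rw [← Real.exp_add]; ring_nf
  have x5 : Real.exp (-(A / 2)) * Real.exp (A / 2) = 1 := by
    rw [← Real.exp_add]; simp
  set p := P.real {ω | X ω ≤ ε}
  have hmain : (1 - 2 * K * Real.exp (-(A * ((r - 1) ^ 2 / 2)))) * Real.exp (-(A * r))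
      ≤ Real.exp (-(A / 2)) * p := by linarith
  calc _ = (1 - 2 * K * Real.exp (-(A * ((r - 1) ^ 2 / 2)))) * Real.exp (-(A * r)) *
        Real.exp (A / 2) := by rw [x4]; ring
    _ ≤ Real.exp (-(A / 2)) * p * Real.exp (A / 2) :=
        mul_le_mul_of_nonneg_right hmain (Real.exp_pos _).le
    _ = p := by linear_combination p * x5

/-- An exponential Tauberian theorem: the rate of decay of the Laplace transform of `X` determines
the small-ball asymptotics of `X`. -/
theorem tendsto_mul_log_measureReal_of_laplace (hX : AEMeasurable X P) (hX0 : ∀ ω, 0 ≤ X ω)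
    {c K : ℝ} (hc : 0 < c) (hK : 0 < K)
    (hlow : ∀ l, 0 < l → Real.exp (-(c * l)) ≤ ∫ ω, Real.exp (-(l ^ 2 / 2 * X ω)) ∂P)
    (hup : ∀ l, 0 < l → ∫ ω, Real.exp (-(l ^ 2 / 2 * X ω)) ∂P ≤ K * Real.exp (-(c * l))) :
    Tendsto (fun ε => ε * Real.log (P.real {ω | X ω ≤ ε})) (𝓝[>] 0) (𝓝 (-(c ^ 2 / 2))) := by
  have hlb : ∀ r : ℝ, 1 < r → ∀ᶠ ε in 𝓝[>] (0 : ℝ),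
      2⁻¹ * Real.exp (-(c ^ 2 / ε * (r - 1 / 2))) ≤ P.real {ω | X ω ≤ ε} := by
    intro r hr
    have hr' : 0 < (r - 1) ^ 2 / 2 := by have := sub_pos.2 hr; positivity
    have t : Tendsto (fun ε : ℝ => 1 - 2 * K * Real.exp (-(c ^ 2 / ε * ((r - 1) ^ 2 / 2))))
        (𝓝[>] 0) (𝓝 (1 - 2 * K * 0)) := by
      refine ((Real.tendsto_exp_neg_atTop_nhds_zero.comp ?_).const_mul _).const_sub _
      have h : Tendsto (fun ε : ℝ => c ^ 2 / ε) (𝓝[>] 0) atTop :=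
        tendsto_inv_nhdsGT_zero.const_mul_atTop (by positivity)
      exact h.atTop_mul_const hr'
    rw [mul_zero, sub_zero] at t
    filter_upwards [t.eventually_const_le (by norm_num : (2⁻¹ : ℝ) < 1), self_mem_nhdsWithin]
      with ε h1 hε
    exact (mul_le_mul_of_nonneg_right h1 (Real.exp_pos _).le).trans
      (exp_le_measureReal_of_laplace hX hX0 hc hlow hup hr hε)
  have hid : Tendsto (fun ε : ℝ => ε) (𝓝[>] 0) (𝓝 0) := tendsto_nhdsWithin_of_tendsto_nhds tendsto_id
  rw [tendsto_order]
  constructor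
  · intro y hy
    obtain ⟨r, hr, hyr⟩ : ∃ r : ℝ, 1 < r ∧ y < -(c ^ 2 * (r - 1 / 2)) := by
      -- This r uses up half of the gap between y and the limit.
      refine ⟨1 + (-(c ^ 2 / 2) - y) / (2 * c ^ 2), ?_, ?_⟩
      · have : 0 < -(c ^ 2 / 2) - y := by linarith
        have : 0 < (-(c ^ 2 / 2) - y) / (2 * c ^ 2) := by positivity
        linarith
      · have : c ^ 2 * (1 + (-(c ^ 2 / 2) - y) / (2 * c ^ 2) - 1 / 2)
          = c ^ 2 / 2 + (-(c ^ 2 / 2) - y) / 2 := by field_simp; ring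
        rw [this]; linarith
    have t : Tendsto (fun ε : ℝ => ε * Real.log 2⁻¹ + -(c ^ 2 * (r - 1 / 2))) (𝓝[>] 0)
        (𝓝 (0 * Real.log 2⁻¹ + -(c ^ 2 * (r - 1 / 2)))) := (hid.mul_const _).add_const _
    filter_upwards [hlb r hr, t.eventually_const_lt (by simpa using hyr), self_mem_nhdsWithin]
      with ε h1 h2 hε
    have hε : 0 < ε := hε
    refine h2.trans_le ?_
    have h3 := mul_le_mul_of_nonneg_left (Real.log_le_log (by positivity) h1) hε.le
    rw [Real.log_mul (by norm_num) (Real.exp_pos _).ne', Real.log_exp] at h3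
    refine le_trans (le_of_eq ?_) h3
    field_simp
  · intro y hy
    have t : Tendsto (fun ε : ℝ => ε * Real.log K + -(c ^ 2 / 2)) (𝓝[>] 0)
        (𝓝 (0 * Real.log K + -(c ^ 2 / 2))) := (hid.mul_const _).add_const _
    -- Any r > 1 would do: the lower bound only ensures a positive probability, needed for
    -- monotonicity of `Real.log`.
    filter_upwards [hlb 2 (by norm_num), t.eventually_lt_const (by simpa using hy),
      self_mem_nhdsWithin] with ε h1 h2 hε
    have hε : 0 < ε := hε
    refine lt_of_le_of_lt ?_ h2
    have hp : 0 < P.real {ω | X ω ≤ ε} := lt_of_lt_of_le (by positivity) h1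
    have h3 : P.real {ω | X ω ≤ ε} ≤
        Real.exp ((c / ε) ^ 2 / 2 * ε) * (K * Real.exp (-(c * (c / ε)))) :=
      (measureReal_le_exp_mul_integral hX hX0 (by positivity) ε).trans
        (mul_le_mul_of_nonneg_left (hup _ (by positivity)) (Real.exp_pos _).le)
    have h4 := mul_le_mul_of_nonneg_left (Real.log_le_log hp h3) hε.le
    rw [Real.log_mul (Real.exp_pos _).ne' (by positivity), Real.log_mul hK.ne'
      (Real.exp_pos _).ne', Real.log_exp, Real.log_exp] at h4
    refine h4.trans (le_of_eq ?_)
    field_simp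
    ring

end Tauberian

/-! ### Riemann sums -/

theorem natCast_mul_div_mem_Icc {T : ℝ} (hT : 0 ≤ T) {k n : ℕ} (hk : k ≤ n) :
    (k : ℝ) * (T / n) ∈ Icc 0 T := by
  refine ⟨by positivity, ?_⟩
  rw [mul_div_left_comm]
  exact mul_le_of_le_one_right hT (div_le_one_of_le₀ (by exact_mod_cast hk) (by positivity))

/-- Convergence of the right Riemann sums of a continuous function. -/
theorem ContinuousOn.tendsto_riemann_sum {T : ℝ} (hT : 0 < T) {f : ℝ → ℝ}
    (hf : ContinuousOn f (Icc 0 T)) :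
    Tendsto (fun n : ℕ => T / n * ∑ k ∈ Finset.range n, f ((k + 1 : ℕ) * (T / n))) atTop
      (𝓝 (∫ t in (0 : ℝ)..T, f t)) := by
  rw [Metric.tendsto_nhds]
  intro ε hε
  obtain ⟨δ, hδ, hfδ⟩ := Metric.uniformContinuousOn_iff.1
    (isCompact_Icc.uniformContinuousOn_of_continuous hf) (ε / (2 * T)) (by positivity)
  filter_upwards [(tendsto_const_div_atTop_nhds_zero_nat T).eventually_lt_const hδ,
    eventually_ge_atTop 1] with n hn hn1
  have hn0 : (0 : ℝ) < n := by exact_mod_cast hn1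
  set h := T / n with hh
  have hhpos : 0 < h := by positivity
  have hsub : ∀ k < n, uIcc ((k : ℝ) * h) ((k + 1 : ℕ) * h) ⊆ Icc 0 T := fun k hk =>
    uIcc_subset_Icc (natCast_mul_div_mem_Icc hT.le hk.le) (natCast_mul_div_mem_Icc hT.le hk)
  have hint : ∀ k < n, IntervalIntegrable f volume ((k : ℝ) * h) ((k + 1 : ℕ) * h) :=
    fun k hk => (hf.mono (hsub k hk)).intervalIntegrable
  have hsum := intervalIntegral.sum_integral_adjacent_intervals
    (a := fun k : ℕ => (k : ℝ) * h) hint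
  have hnh : (n : ℝ) * h = T := by rw [hh]; field_simp
  simp only [Nat.cast_zero, zero_mul, hnh] at hsum
  rw [← hsum, Real.dist_eq, Finset.mul_sum, ← Finset.sum_sub_distrib]
  have hlen : ∀ k : ℕ, ((k + 1 : ℕ) : ℝ) * h - k * h = h := fun k => by push_cast; ring
  have hterm : ∀ k ∈ Finset.range n, |h * f ((k + 1 : ℕ) * h)
      - ∫ t in ((k : ℝ) * h)..((k + 1 : ℕ) * h), f t| ≤ ε / (2 * T) * h := by
    intro k hk
    have hk := Finset.mem_range.1 hk
    have e : h * f ((k + 1 : ℕ) * h) - ∫ t in ((k : ℝ) * h)..((k + 1 : ℕ) * h), f t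
        = ∫ t in ((k : ℝ) * h)..((k + 1 : ℕ) * h), (f ((k + 1 : ℕ) * h) - f t) := by
      rw [intervalIntegral.integral_sub intervalIntegrable_const (hint k hk),
        intervalIntegral.integral_const, hlen, smul_eq_mul]
    rw [e]
    have := intervalIntegral.norm_integral_le_of_norm_le_const (a := (k : ℝ) * h)
      (b := (k + 1 : ℕ) * h) (C := ε / (2 * T)) (f := fun t => f ((k + 1 : ℕ) * h) - f t) ?_
    · rwa [hlen, abs_of_pos hhpos] at this
    · intro t ht
      have ht' := hsub k hk (uIoc_subset_uIcc ht)
      rw [uIoc_of_le (by linarith [hlen k])] at ht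
      refine (hfδ _ (natCast_mul_div_mem_Icc hT.le hk) t ht' ?_).le
      rw [Real.dist_eq, abs_of_nonneg (by linarith [ht.2])]
      linarith [hlen k, ht.1]
  refine (Finset.abs_sum_le_sum_abs _ _).trans_lt ((Finset.sum_le_sum hterm).trans_lt ?_)
  rw [Finset.sum_const, Finset.card_range, nsmul_eq_mul, mul_left_comm, hnh]
  have : ε / (2 * T) * T = ε / 2 := by field_simp
  linarith

/-! ### Laplace transform of the Brownian energy -/

section Brownian

variable {Ω : Type*} [MeasurableSpace Ω] {P : Measure Ω} {T : ℝ}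

theorem IsStandardBrownianOn.aemeasurable {b : ℝ → Ω → ℝ} (hb : IsStandardBrownianOn T b P)
    {t : ℝ} (ht : t ∈ Icc 0 T) : AEMeasurable (b t) P := by
  refine (hb.law_increments 0 t le_rfl ht.1 ht.2).aemeasurable.congr ?_
  filter_upwards [hb.start_zero] with ω hω
  rw [hω, sub_zero]

/-- The Laplace transform of the energy of a Brownian motion sampled at equally spaced times. -/
theorem IsStandardBrownianOn.integral_exp_neg_sum_sq [IsProbabilityMeasure P] {b : ℝ → Ω → ℝ}
    (hb : IsStandardBrownianOn T b P) (hT : 0 < T) {n : ℕ} (hn : n ≠ 0) {a m : ℝ} (ha : 0 ≤ a)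
    (ham : a * (T / n) = Real.cosh m - 1) :
    ∫ ω, Real.exp (-(a * ∑ k ∈ Finset.range n, b ((k + 1 : ℕ) * (T / n)) ω ^ 2)) ∂P
      = (√(Real.cosh ((n + 1 / 2) * m) / Real.cosh (m / 2)))⁻¹ := by
  have hn0 : (0 : ℝ) < n := by positivity
  set v : NNReal := (T / n).toNNReal with hv
  have hvT : (v : ℝ) = T / n := Real.coe_toNNReal _ (by positivity)
  have hv0 : v ≠ 0 := by
    rw [hv]; exact (Real.toNNReal_pos.2 (by positivity)).ne'
  let X : Fin n → Ω → ℝ := fun i ω => b ((i + 1 : ℕ) * (T / n)) ω - b ((i : ℕ) * (T / n)) ω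
  have hlaw : ∀ i, HasLaw (X i) (gaussianReal 0 v) P := by
    intro i
    have := hb.law_increments ((i : ℕ) * (T / n)) ((i + 1 : ℕ) * (T / n))
      (natCast_mul_div_mem_Icc hT.le i.2.le).1 (by gcongr; simp)
      (natCast_mul_div_mem_Icc hT.le i.2).2
    have e : ((i + 1 : ℕ) : ℝ) * (T / n) - (i : ℕ) * (T / n) = T / n := by push_cast; ring
    rwa [e] at this
  have hind : iIndepFun X P := by
    refine hb.indep_increments n (fun i => ⟨(i : ℕ) * (T / n),
      natCast_mul_div_mem_Icc hT.le (Nat.lt_succ_iff.1 i.2)⟩) fun i j hij => ?_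
    have : (i : ℕ) ≤ j := hij
    change ((i : ℕ) : ℝ) * (T / n) ≤ (j : ℕ) * (T / n)
    gcongr
  have hmap : P.map (fun ω i => X i ω) = Measure.pi fun _ => gaussianReal 0 v := by
    rw [hind.map_fun_eq_pi_map fun i => (hlaw i).aemeasurable]
    congr with i
    rw [(hlaw i).map_eq]
  have hwalk := integral_exp_neg_walkEnergy hv0 ha (hvT ▸ ham) n 0
  have hcont : Continuous fun y : Fin n → ℝ => Real.exp (-(a * walkEnergy n 0 y)) := by
    have : Continuous fun y : Fin n → ℝ => walkEnergy n 0 y :=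
      (continuous_walkEnergy n).comp (by fun_prop : Continuous fun y : Fin n → ℝ => ((0 : ℝ), y))
    fun_prop
  rw [← hmap, integral_map (aemeasurable_pi_lambda _ fun i => (hlaw i).aemeasurable)
    hcont.aestronglyMeasurable] at hwalk
  simp only [ne_eq, OfNat.ofNat_ne_zero, not_false_eq_true, zero_pow, mul_zero, zero_div, neg_zero,
    Real.exp_zero, mul_one] at hwalk
  rw [← hwalk]
  refine integral_congr_ae ?_
  filter_upwards [hb.start_zero] with ω hω
  have := walkEnergy_increments n fun k : ℕ => b (k * (T / n)) ω
  simp only [Nat.cast_zero, zero_mul, hω] at this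
  rw [← this]

theorem IsStandardBrownianVecOn.integral_exp_neg_sum_norm_sq [IsProbabilityMeasure P] {N : ℕ}
    {w : ℝ → Ω → EuclideanSpace ℝ (Fin N)} (hw : IsStandardBrownianVecOn T w P) (hT : 0 < T)
    {n : ℕ} (hn : n ≠ 0) {a m : ℝ} (ha : 0 ≤ a) (ham : a * (T / n) = Real.cosh m - 1) :
    ∫ ω, Real.exp (-(a * ∑ k ∈ Finset.range n, ‖w ((k + 1 : ℕ) * (T / n)) ω‖ ^ 2)) ∂P
      = (√(Real.cosh ((n + 1 / 2) * m) / Real.cosh (m / 2)))⁻¹ ^ N := by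
  have hprod : ∀ ω, Real.exp (-(a * ∑ k ∈ Finset.range n, ‖w ((k + 1 : ℕ) * (T / n)) ω‖ ^ 2))
      = ∏ i, Real.exp (-(a * ∑ k ∈ Finset.range n, w ((k + 1 : ℕ) * (T / n)) ω i ^ 2)) := by
    intro ω
    rw [← Real.exp_sum, Finset.sum_neg_distrib, ← Finset.mul_sum, Finset.sum_comm]
    simp_rw [EuclideanSpace.real_norm_sq_eq]
  simp_rw [hprod]
  have hind : iIndepFun (fun (i : Fin N) (ω : Ω) =>
      Real.exp (-(a * ∑ k ∈ Finset.range n, w ((k + 1 : ℕ) * (T / n)) ω i ^ 2))) P := by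
    -- `projIcc` only supplies membership in the index set; it fixes every sampled time.
    have := hw.indep_components.comp (fun _ (x : Icc (0 : ℝ) T → ℝ) =>
      Real.exp (-(a * ∑ k ∈ Finset.range n,
        x (projIcc 0 T hT.le ((k + 1 : ℕ) * (T / n))) ^ 2))) (fun _ => by fun_prop)
    convert this using 3 with i ω
    simp only [Function.comp]
    congr 3
    refine Finset.sum_congr rfl fun k hk => ?_
    rw [projIcc_of_mem hT.le (natCast_mul_div_mem_Icc hT.le (Finset.mem_range.1 hk))]
  rw [hind.integral_fun_prod_eq_prod_integral]
  · simp_rw [fun i => (hw.component i).integral_exp_neg_sum_sq hT hn ha ham]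
    simp
  · intro i
    have : AEMeasurable (fun ω => ∑ k ∈ Finset.range n, w ((k + 1 : ℕ) * (T / n)) ω i ^ 2) P :=
      Finset.aemeasurable_fun_sum _ fun k hk => ((hw.component i).aemeasurable
        (natCast_mul_div_mem_Icc hT.le (Finset.mem_range.1 hk))).pow_const 2
    exact (by fun_prop : AEMeasurable _ P).aestronglyMeasurable

theorem IsStandardBrownianVecOn.aemeasurable_norm_sq {N : ℕ}
    {w : ℝ → Ω → EuclideanSpace ℝ (Fin N)} (hw : IsStandardBrownianVecOn T w P) {t : ℝ}
    (ht : t ∈ Icc 0 T) : AEMeasurable (fun ω => ‖w t ω‖ ^ 2) P := by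
  simp_rw [EuclideanSpace.real_norm_sq_eq]
  exact Finset.aemeasurable_fun_sum _ fun i _ => ((hw.component i).aemeasurable ht).pow_const 2

theorem IsStandardBrownianVecOn.ae_tendsto_riemann_sum {N : ℕ}
    {w : ℝ → Ω → EuclideanSpace ℝ (Fin N)} (hw : IsStandardBrownianVecOn T w P) (hT : 0 < T) :
    ∀ᵐ ω ∂P, Tendsto (fun n : ℕ => T / n * ∑ k ∈ Finset.range n,
      ‖w ((k + 1 : ℕ) * (T / n)) ω‖ ^ 2) atTop (𝓝 (∫ t in (0 : ℝ)..T, ‖w t ω‖ ^ 2)) := by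
  filter_upwards [ae_all_iff.2 fun i => (hw.component i).continuous_paths] with ω hω
  refine ContinuousOn.tendsto_riemann_sum hT (f := fun t => ‖w t ω‖ ^ 2) ?_
  simp_rw [EuclideanSpace.real_norm_sq_eq]
  exact continuousOn_finsetSum _ fun i _ => (hω i).pow 2

theorem IsStandardBrownianVecOn.aemeasurable_riemann_sum {N : ℕ}
    {w : ℝ → Ω → EuclideanSpace ℝ (Fin N)} (hw : IsStandardBrownianVecOn T w P) (hT : 0 < T)
    (n : ℕ) : AEMeasurable (fun ω => ∑ k ∈ Finset.range n, ‖w ((k + 1 : ℕ) * (T / n)) ω‖ ^ 2) P :=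
  Finset.aemeasurable_fun_sum _ fun _ hk =>
    hw.aemeasurable_norm_sq (natCast_mul_div_mem_Icc hT.le (Finset.mem_range.1 hk))

/-- Path continuity makes the integral an almost sure limit of Riemann sums, so joint measurability
of `w` is not needed. -/
theorem IsStandardBrownianVecOn.aemeasurable_integral {N : ℕ}
    {w : ℝ → Ω → EuclideanSpace ℝ (Fin N)} (hw : IsStandardBrownianVecOn T w P) (hT : 0 < T) :
    AEMeasurable (fun ω => ∫ t in (0 : ℝ)..T, ‖w t ω‖ ^ 2) P :=
  aemeasurable_of_tendsto_metrizable_ae atTop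
    (fun n => (hw.aemeasurable_riemann_sum hT n).const_mul _) (hw.ae_tendsto_riemann_sum hT)

theorem tendsto_cosh_mul_sub_one_div_sq (l : ℝ) :
    Tendsto (fun h => (Real.cosh (l * h) - 1) / h ^ 2) (𝓝[≠] 0) (𝓝 (l ^ 2 / 2)) := by
  have hd : HasDerivAt (fun h => Real.sinh (l / 2 * h)) (l / 2) 0 := by
    simpa using ((hasDerivAt_id (0 : ℝ)).const_mul (l / 2)).sinh
  have ht := ((hasDerivAt_iff_tendsto_slope_zero.1 hd).pow 2).const_mul 2
  have e : 2 * (l / 2) ^ 2 = l ^ 2 / 2 := by ring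
  rw [e] at ht
  refine ht.congr fun h => ?_
  have e2 : Real.cosh (l * h) - 1 = 2 * Real.sinh (l / 2 * h) ^ 2 := by
    have : l * h = 2 * (l / 2 * h) := by ring
    rw [this, Real.cosh_two_mul, Real.cosh_sq]
    ring
  rw [e2]
  simp only [zero_add, mul_zero, Real.sinh_zero, sub_zero, smul_eq_mul]
  ring

/-- The Laplace transform of the squared `L²` norm of a Brownian path. -/
theorem IsStandardBrownianVecOn.integral_exp_neg_integral_norm_sq [IsProbabilityMeasure P] {N : ℕ}
    {w : ℝ → Ω → EuclideanSpace ℝ (Fin N)} (hw : IsStandardBrownianVecOn T w P) (hT : 0 < T)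
    (l : ℝ) :
    ∫ ω, Real.exp (-(l ^ 2 / 2 * ∫ t in (0 : ℝ)..T, ‖w t ω‖ ^ 2)) ∂P
      = (√(Real.cosh (l * T)))⁻¹ ^ N := by
  -- Chosen so that the discrete formula holds exactly with m = lT/n. Since a n / (T/n) → l²/2, the
  -- discrete exponent still converges to the right limit.
  let a : ℕ → ℝ := fun n => (Real.cosh (l * (T / n)) - 1) / (T / n)
  have ha : ∀ n, 0 ≤ a n := fun n =>
    div_nonneg (sub_nonneg.2 (Real.one_le_cosh _)) (by positivity)
  have hh : Tendsto (fun n : ℕ => T / n) atTop (𝓝[≠] 0) := by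
    refine tendsto_nhdsWithin_iff.2 ⟨tendsto_const_div_atTop_nhds_zero_nat T, ?_⟩
    filter_upwards [eventually_ge_atTop 1] with n hn
    have : (0 : ℝ) < n := by exact_mod_cast hn
    exact (div_pos hT this).ne'
  have hleft : Tendsto (fun n : ℕ => ∫ ω, Real.exp (-(a n * ∑ k ∈ Finset.range n,
      ‖w ((k + 1 : ℕ) * (T / n)) ω‖ ^ 2)) ∂P) atTop
      (𝓝 (∫ ω, Real.exp (-(l ^ 2 / 2 * ∫ t in (0 : ℝ)..T, ‖w t ω‖ ^ 2)) ∂P)) := by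
    refine tendsto_integral_of_dominated_convergence (fun _ => 1) (fun n => ?_)
      (integrable_const _) (fun n => ae_of_all _ fun ω => ?_) ?_
    · have := hw.aemeasurable_riemann_sum hT n
      exact (by fun_prop : AEMeasurable _ P).aestronglyMeasurable
    · rw [Real.norm_eq_abs, Real.abs_exp, Real.exp_le_one_iff, neg_nonpos]
      exact mul_nonneg (ha n) (Finset.sum_nonneg fun _ _ => sq_nonneg _)
    · filter_upwards [hw.ae_tendsto_riemann_sum hT] with ω hω
      refine (Real.continuous_exp.tendsto _).comp (Tendsto.neg ?_)
      refine (((tendsto_cosh_mul_sub_one_div_sq l).comp hh).mul hω).congr' ?_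
      filter_upwards [eventually_ge_atTop 1] with n hn
      have : (0 : ℝ) < n := by exact_mod_cast hn
      simp only [Function.comp, a]
      field_simp
  have hright : Tendsto (fun n : ℕ => (√(Real.cosh (l * T + l * (T / n) / 2) /
      Real.cosh (l * (T / n) / 2)))⁻¹ ^ N) atTop (𝓝 ((√(Real.cosh (l * T)))⁻¹ ^ N)) := by
    have hc : Continuous fun h : ℝ =>
        (√(Real.cosh (l * T + l * h / 2) / Real.cosh (l * h / 2)))⁻¹ ^ N := by
      refine Continuous.pow (Continuous.inv₀ (Real.continuous_sqrt.comp (Continuous.div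
        (by fun_prop) (by fun_prop) fun h => (Real.cosh_pos _).ne')) fun h => ?_) N
      exact (Real.sqrt_pos.2 (div_pos (Real.cosh_pos _) (Real.cosh_pos _))).ne'
    have := (hc.tendsto 0).comp (tendsto_const_div_atTop_nhds_zero_nat T)
    simpa [Function.comp_def] using this
  refine tendsto_nhds_unique hleft (hright.congr' ?_)
  filter_upwards [eventually_ge_atTop 1] with n hn
  have hn' : (0 : ℝ) < n := by exact_mod_cast hn
  rw [hw.integral_exp_neg_sum_norm_sq hT (by omega) (ha n) (m := l * (T / n))
    (by simp only [a]; field_simp)]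
  have : ((n : ℝ) + 1 / 2) * (l * (T / n)) = l * T + l * (T / n) / 2 := by field_simp
  rw [this]

end Brownian

/-! ### Exponential bounds on the transform and conclusion -/

theorem exp_neg_half_le_inv_sqrt_cosh {x : ℝ} (hx : 0 ≤ x) :
    Real.exp (-(x / 2)) ≤ (√(Real.cosh x))⁻¹ := by
  rw [Real.exp_neg, Real.exp_half]
  refine inv_anti₀ (Real.sqrt_pos.2 (Real.cosh_pos x)) (Real.sqrt_le_sqrt ?_)
  rw [Real.cosh_eq]
  have : Real.exp (-x) ≤ Real.exp x := Real.exp_le_exp.2 (by linarith)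
  linarith

theorem inv_sqrt_cosh_le (x : ℝ) : (√(Real.cosh x))⁻¹ ≤ √2 * Real.exp (-(x / 2)) := by
  rw [Real.exp_neg, Real.exp_half, ← Real.sqrt_inv, ← Real.sqrt_inv,
    ← Real.sqrt_mul (by norm_num)]
  refine Real.sqrt_le_sqrt ?_
  rw [← div_eq_mul_inv, ← inv_div, Real.cosh_eq]
  refine inv_anti₀ (by positivity) ?_
  have := Real.exp_pos (-x)
  linarith

theorem mainTheorem8 {Ω : Type*} [MeasurableSpace Ω] (P : Measure Ω) [IsProbabilityMeasure P]
    (N : ℕ) (hN : 1 ≤ N) (T : ℝ) (hT : 0 < T)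
    (w : ℝ → Ω → EuclideanSpace ℝ (Fin N)) (hw : IsStandardBrownianVecOn T w P) :
    (fun ε : ℝ => Real.log (P.real {ω | ∫ t in (0 : ℝ)..T, ‖w t ω‖ ^ 2 ≤ ε}))
      ~[𝓝[>] (0 : ℝ)] (fun ε : ℝ => -((N : ℝ) ^ 2 * T ^ 2 / 8) * ε⁻¹) := by
  have hN0 : (0 : ℝ) < N := by exact_mod_cast hN
  have hexp : ∀ l : ℝ, Real.exp (-(N * T / 2 * l)) = Real.exp (-(l * T / 2)) ^ N := by
    intro l
    rw [← Real.exp_nat_mul]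
    ring_nf
  have hlim := tendsto_mul_log_measureReal_of_laplace (hw.aemeasurable_integral hT)
    (fun ω => intervalIntegral.integral_nonneg hT.le fun _ _ => sq_nonneg _)
    (c := N * T / 2) (K := √2 ^ N) (by positivity) (by positivity)
    (fun l hl => by
      rw [hw.integral_exp_neg_integral_norm_sq hT, hexp]
      exact pow_le_pow_left₀ (Real.exp_pos _).le
        (exp_neg_half_le_inv_sqrt_cosh (by positivity)) N)
    (fun l hl => by
      rw [hw.integral_exp_neg_integral_norm_sq hT, hexp, ← mul_pow]
      exact pow_le_pow_left₀ (by positivity) (inv_sqrt_cosh_le _) N)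
  have hC : -((N : ℝ) ^ 2 * T ^ 2 / 8) ≠ 0 := neg_ne_zero.2 (by positivity)
  rw [isEquivalent_iff_tendsto_one]
  · have h := hlim.div_const (-((N : ℝ) ^ 2 * T ^ 2 / 8))
    have e : -((N * T / 2) ^ 2 / 2) / -((N : ℝ) ^ 2 * T ^ 2 / 8) = 1 := by
      rw [div_eq_one_iff_eq hC]; ring
    rw [e] at h
    refine h.congr fun ε => ?_
    rw [Pi.div_apply, mul_comm (-((N : ℝ) ^ 2 * T ^ 2 / 8)), ← div_div, div_inv_eq_mul,
      mul_comm ε]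
  · filter_upwards [self_mem_nhdsWithin] with ε hε
    exact mul_ne_zero hC (inv_ne_zero (ne_of_gt hε))
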